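/- **Theorem 3.1.** Let $n$ be the space dimension, $D=-i\nabla$, $\langle\xi\rangle=\sqrt{1+|\xi|^2}$ and $[\xi]=|\xi|/\langle\xi\rangle$, and let $|D|$, $\langle D\rangle$, $[D]^\kappa$ be the Fourier multipliers with the symbols $|\xi|$, $\langle\xi\rangle$, $[\xi]^\kappa$. For $\kappa\ge 0$ put $$[D]^\kappa L^2(\mathbb R^n)=\{[D]^\kappa f \mid f\in L^2(\mathbb R^n)\},\qquad \|g\|_{[D]^\kappa L^2}=\|[D]^{-\kappa}g\|_2 .$$ Let $\mu>2$ and $\kappa\ge 0$. Then there is a constant $C>0$, depending only on $n$, $\mu$ and $\kappa$, such that the following holds. Let $u_1\in H^1(\mathbb R^n)$ and $u_2\in L^2(\mathbb R^n)$ satisfy $\langle D\rangle u_1,\,u_2\in[D]^\kappa L^2(\mathbb R^n)$, and let $u\in C^1([0,\infty),L^2(\mathbb R^n))\cap C([0,\infty),H^1(\mathbb R^n))$ be the solution, in the sense of distributions, of the Cauchy problem $$u_{tt}-\Delta u+\frac{\mu}{1+t}\,u_t=0,\qquad u(0,\cdot)=u_1,\quad u_t(0,\cdot)=u_2 .$$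 Then for all $t\ge 0$ $$\big\||D|u(t,\cdot)\big\|_2+\|u_t(t,\cdot)\|_2\le C\,\Big(\|\langle D\rangle u_1\|_{[D]^\kappa L^2}+\|u_2\|_{[D]^\kappa L^2}\Big)\cdot\begin{cases}(1+t)^{-1-\kappa}, & 0\le\kappa\le\frac{\mu-2}{2},\\ (1+t)^{-\mu/2}, & \kappa\ge\frac{\mu-2}{2}.\end{cases}$$ -/

import Mathlib

open MeasureTheory Set
open scoped FourierTransform SchwartzMap Laplacian

namespace DissipativeWave

noncomputable section

/-- The complex Hilbert space `L²(ℝⁿ)`. -/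
abbrev L2 (n : ℕ) : Type := Lp ℂ 2 (volume : Measure (EuclideanSpace ℝ (Fin n)))

/-- `f` lies in the domain of the Fourier multiplier `m(D)`, i.e. `m f̂ ∈ L²`, where `D = -i∇`.
Mathlib's Fourier transform has the kernel `exp (-2πi x·ξ)`, so that the differential operator `D`
corresponds to multiplication by `2πξ`. -/
def InDomain {n : ℕ} (m : EuclideanSpace ℝ (Fin n) → ℝ) (f : L2 n) : Prop :=
  MemLp (fun ξ => (m ((2 * Real.pi) • ξ) : ℂ) * (𝓕 f : L2 n) ξ) 2 volume

open Classical in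
/-- The Fourier multiplier `m(D) f = 𝓕⁻¹ (m 𝓕 f)` as an (unbounded) operator on `L²(ℝⁿ)`.
The value outside the domain of the operator is irrelevant, and set to `0`. -/
def fourierMul {n : ℕ} (m : EuclideanSpace ℝ (Fin n) → ℝ) (f : L2 n) : L2 n :=
  if h : InDomain m f then 𝓕⁻ (h.toLp : L2 n) else 0

/-- The symbol `⟨ξ⟩ = √(1 + |ξ|²)`. -/
def japanese {n : ℕ} (ξ : EuclideanSpace ℝ (Fin n)) : ℝ := Real.sqrt (1 + ‖ξ‖ ^ 2)

/-- The symbol `[ξ] = |ξ| / ⟨ξ⟩`. -/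
def bracket {n : ℕ} (ξ : EuclideanSpace ℝ (Fin n)) : ℝ := ‖ξ‖ / japanese ξ

/-- The operator `|D|`. -/
def absD {n : ℕ} (f : L2 n) : L2 n := fourierMul (fun ξ => ‖ξ‖) f

/-- The operator `⟨D⟩`. -/
def japaneseD {n : ℕ} (f : L2 n) : L2 n := fourierMul japanese f

/-- The operator `[D] ^ κ`, for real `κ`. -/
def bracketD {n : ℕ} (κ : ℝ) (f : L2 n) : L2 n := fourierMul (fun ξ => bracket ξ ^ κ) f

/-- The Sobolev space `H¹(ℝⁿ)`, the domain of `⟨D⟩`, normed by `‖⟨D⟩ f‖₂`. -/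
def H1 (n : ℕ) : Set (L2 n) := {f | InDomain japanese f}

/-- The space `[D]^κ L² = {[D]^κ f | f ∈ L²}`. -/
def bracketSpace (n : ℕ) (κ : ℝ) : Set (L2 n) :=
  {g | ∃ f : L2 n, InDomain (fun ξ => bracket ξ ^ κ) f ∧ bracketD κ f = g}

/-- The norm `‖g‖_{[D]^κ L²} = ‖[D]^{-κ} g‖₂`; every `g ∈ [D]^κ L²` is in the domain of
`[D]^{-κ}`. -/
def bracketNorm {n : ℕ} (κ : ℝ) (g : L2 n) : ℝ := ‖bracketD (-κ) g‖

/-- The time derivative on `[0, ∞)` of an `L²`-valued function (one-sided at `t = 0`). -/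
def timeDeriv {n : ℕ} (u : ℝ → L2 n) (t : ℝ) : L2 n := derivWithin u (Ici 0) t

/-- `u ∈ C¹([0,∞), L²) ∩ C([0,∞), H¹)` solves the Cauchy problem
`u_tt - Δu + μ/(1+t) u_t = 0`, `u(0) = u₁`, `u_t(0) = u₂`.
The equation holds in the distributional sense: for each `t > 0` the time derivative of `u_t`,
as a tempered distribution on `ℝⁿ`, is `Δu - μ/(1+t) u_t`. -/
structure IsSolution {n : ℕ} (μ : ℝ) (u₁ u₂ : L2 n) (u : ℝ → L2 n) : Prop where
  contDiffOn : ContDiffOn ℝ 1 u (Ici 0)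
  mem_H1 : ∀ t, 0 ≤ t → u t ∈ H1 n
  continuousOn_H1 : ContinuousOn (fun t => japaneseD (u t)) (Ici 0)
  equation : ∀ t, 0 < t → ∀ φ : 𝓢(EuclideanSpace ℝ (Fin n), ℂ),
    HasDerivAt (fun s => Lp.toTemperedDistribution (timeDeriv u s) φ)
      (Δ (Lp.toTemperedDistribution (u t)) φ
        - ((μ / (1 + t) : ℝ) : ℂ) * Lp.toTemperedDistribution (timeDeriv u t) φ) t
  initial : u 0 = u₁
  initial_deriv : timeDeriv u 0 = u₂

end

end DissipativeWave

/-! On the Fourier side each frequency k is a damped oscillator x'' + k²x + μ/(1+t) x' = 0. With τ =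
1 + t, two regimes meet at kτ = μ. For kτ ≤ μ the term k²x is a perturbation: at k = 0 the quantity
τx' + (μ-1)x is conserved, and a quadratic form built on it bounds the energy by τ⁻² times |x(0)|² +
|x'(0)|² (`low_zone`). For kτ ≥ μ the Liouville substitution v = τ^(μ/2) x nearly conserves its
energy, so that of x decays like τ^(-μ) (`high_zone`).

Data in [D]^κ L² bring a factor k^(2κ), worth τ^(-2κ) as long as kτ ≤ μ. The energy is thus
O(τ^(-2-2κ)) up to τ₀ = μ/k and gains (τ/τ₀)^(-μ) afterwards. This is O(τ^(-2θ)) uniformly in k as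
soon as θ ≤ 1 + κ and 2θ ≤ μ (`EnergyData.decay`); the theorem takes the largest such θ.

The equation holds only in the sense of distributions for an L²-valued curve, so the oscillator is
not solved pointwise in ξ. Division by 1 + |ξ|² makes it a strong equation in L²
(`hasDerivAt_resolvent`); on a dyadic shell the division can be undone, and the norms of the
localised solution obey the oscillator's identities with k known up to a factor 2
(`IsSolution.energyData`). The constants are the same on all shells, so summation and Plancherel
finish the proof. -/

namespace DissipativeWave

/-! ### Energy estimates for the damped oscillator -/

/-- The quadratic quantities `p = |x|²`, `q = Re ⟨x, y⟩`, `r = |y|²`, `s = |k x|²` attached to a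
solution of `x' = y`, `y' = -k² x - μ/(1+t) y`, with the frequencies `k` in `[a, 2a]`. -/
structure EnergyData (μ a : ℝ) (p q r s w : ℝ → ℝ) : Prop where
  cont_p : ContinuousOn p (Ici 0)
  cont_q : ContinuousOn q (Ici 0)
  cont_r : ContinuousOn r (Ici 0)
  cont_s : ContinuousOn s (Ici 0)
  deriv_p : ∀ t, 0 < t → HasDerivAt p (2 * q t) t
  deriv_q : ∀ t, 0 < t → HasDerivAt q (r t - s t - μ / (1 + t) * q t) t
  deriv_r : ∀ t, 0 < t → HasDerivAt r (-2 * w t - 2 * (μ / (1 + t)) * r t) t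
  deriv_s : ∀ t, 0 < t → HasDerivAt s (2 * w t) t
  p_nonneg : ∀ t, 0 ≤ t → 0 ≤ p t
  r_nonneg : ∀ t, 0 ≤ t → 0 ≤ r t
  sq_le : ∀ t, 0 ≤ t → q t ^ 2 ≤ p t * r t
  le_s : ∀ t, 0 ≤ t → a ^ 2 * p t ≤ s t
  s_le : ∀ t, 0 ≤ t → s t ≤ 4 * a ^ 2 * p t

lemma antitoneOn_Ici_of_hasDerivAt_nonpos {G G' : ℝ → ℝ} {t₀ : ℝ}
    (hc : ContinuousOn G (Ici t₀)) (hd : ∀ t, t₀ < t → HasDerivAt G (G' t) t)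
    (h : ∀ t, t₀ < t → G' t ≤ 0) : AntitoneOn G (Ici t₀) := by
  refine antitoneOn_of_deriv_nonpos (convex_Ici t₀) hc ?_ ?_
  · intro t ht
    rw [interior_Ici] at ht
    exact (hd t ht).differentiableAt.differentiableWithinAt
  · intro t ht
    rw [interior_Ici] at ht
    rw [(hd t ht).deriv]
    exact h t ht

namespace EnergyData

variable {μ a : ℝ} {p q r s w : ℝ → ℝ}

lemma s_nonneg (h : EnergyData μ a p q r s w) {t : ℝ} (ht : 0 ≤ t) : 0 ≤ s t :=
  (mul_nonneg (sq_nonneg a) (h.p_nonneg t ht)).trans (h.le_s t ht)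

/-- A cross term is controlled by the two squares. -/
lemma abs_mul_q_le (h : EnergyData μ a p q r s w) {t : ℝ} (ht : 0 ≤ t) (b c : ℝ) :
    2 * |b * c * q t| ≤ b ^ 2 * p t + c ^ 2 * r t := by
  have hp := h.p_nonneg t ht
  have hr := h.r_nonneg t ht
  have hq := h.sq_le t ht
  have hn : 0 ≤ b ^ 2 * p t + c ^ 2 * r t := by positivity
  have : |2 * (b * c * q t)| ≤ b ^ 2 * p t + c ^ 2 * r t := by
    refine abs_le_of_sq_le_sq ?_ hn
    have h1 : (b * c) ^ 2 * q t ^ 2 ≤ (b * c) ^ 2 * (p t * r t) := by gcongr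
    nlinarith [sq_nonneg (b ^ 2 * p t - c ^ 2 * r t)]
  rwa [abs_mul, abs_two] at this

/-- The decay estimate in the zone of low frequencies, `a (1 + t) ≤ μ`. -/
lemma low_zone (h : EnergyData μ a p q r s w) (hμ : 2 < μ) (ha : 0 ≤ a) {t : ℝ} (ht : 0 ≤ t)
    (hat : a * (1 + t) ≤ μ) :
    (1 + t) ^ 2 * (r t + s t) ≤ Real.exp (8 * μ ^ 2) * (12 * μ ^ 2) * (p 0 + r 0) := by
  -- R = |(1+t)y + (μ-1)x|² + (1+t)² r + 2(1+t)² s, whose first vector is constant at zero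
  -- frequency. In R' the terms in q and w cancel.
  set R : ℝ → ℝ := fun t => 2 * (1 + t) ^ 2 * r t + 2 * (μ - 1) * ((1 + t) * q t)
    + (μ - 1) ^ 2 * p t + 2 * (1 + t) ^ 2 * s t with hR
  have hdR : ∀ t, 0 < t → HasDerivAt R
      (-2 * (μ - 1) * (1 + t) * r t + (6 - 2 * μ) * (1 + t) * s t) t := by
    intro t ht
    have hτ : HasDerivAt (fun t : ℝ => 1 + t) 1 t := (hasDerivAt_id t).const_add 1
    have h2 : HasDerivAt (fun t : ℝ => 2 * (1 + t) ^ 2) (4 * (1 + t)) t := by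
      exact ((hτ.pow 2).const_mul 2).congr_deriv (by push_cast; ring)
    have : 1 + t ≠ 0 := by positivity
    refine HasDerivAt.congr_deriv ((((h2.mul (h.deriv_r t ht)).add
      ((hτ.mul (h.deriv_q t ht)).const_mul (2 * (μ - 1)))).add
      ((h.deriv_p t ht).const_mul ((μ - 1) ^ 2))).add (h2.mul (h.deriv_s t ht))) ?_
    field_simp
    ring
  -- `R` dominates the energy and `p`
  have hRr : ∀ t, 0 ≤ t → (1 + t) ^ 2 * (r t + s t) ≤ R t := by
    intro t ht
    have h1 := h.abs_mul_q_le ht (μ - 1) (1 + t)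
    have h2 := neg_abs_le ((μ - 1) * (1 + t) * q t)
    have h3 := mul_nonneg (sq_nonneg (1 + t)) (h.s_nonneg ht)
    simp only [hR]
    nlinarith
  have hRp : ∀ t, 0 ≤ t → p t ≤ 2 * R t := by
    intro t ht
    have h1 := h.abs_mul_q_le ht (μ - 1) (2 * (1 + t))
    have h2 := neg_abs_le ((μ - 1) * (2 * (1 + t)) * q t)
    have h3 := mul_nonneg (sq_nonneg (1 + t)) (h.s_nonneg ht)
    have h4 : p t ≤ (μ - 1) ^ 2 * p t := by
      nlinarith [h.p_nonneg t ht, mul_nonneg (h.p_nonneg t ht) (by linarith : 0 ≤ μ - 2)]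
    simp only [hR]
    linarith
  -- R' ≤ 2(1+t)s, s ≤ 4a²p and p ≤ 2R give R' ≤ 16a²(1+t)R; the exponential is the corresponding
  -- Gronwall factor.
  set G : ℝ → ℝ := fun t => Real.exp (-(8 * a ^ 2 * (1 + t) ^ 2)) * R t with hG
  have hdG : ∀ t, 0 < t → HasDerivAt G
      (Real.exp (-(8 * a ^ 2 * (1 + t) ^ 2)) * (-(16 * a ^ 2 * (1 + t)) * R t +
        (-2 * (μ - 1) * (1 + t) * r t + (6 - 2 * μ) * (1 + t) * s t))) t := by
    intro t ht
    have hτ : HasDerivAt (fun t : ℝ => 1 + t) 1 t := (hasDerivAt_id t).const_add 1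
    have h2 : HasDerivAt (fun t : ℝ => -(8 * a ^ 2 * (1 + t) ^ 2)) (-(16 * a ^ 2 * (1 + t))) t := by
      exact ((hτ.pow 2).const_mul (8 * a ^ 2)).neg.congr_deriv (by push_cast; ring)
    exact (h2.exp.mul (hdR t ht)).congr_deriv (by ring)
  have hcR : ContinuousOn R (Ici 0) := by
    have := h.cont_p; have := h.cont_q; have := h.cont_r; have := h.cont_s
    fun_prop
  have hanti : AntitoneOn G (Ici 0) := by
    refine antitoneOn_Ici_of_hasDerivAt_nonpos (by fun_prop) hdG fun t ht => ?_
    refine mul_nonpos_of_nonneg_of_nonpos (Real.exp_pos _).le ?_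
    have h0 := h.s_nonneg ht.le
    have h1 := h.r_nonneg t ht.le
    have h2 := hRp t ht.le
    have h3 := h.s_le t ht.le
    have h4 : (1 + t) * s t ≤ (1 + t) * (4 * a ^ 2 * (2 * R t)) := by
      have : 4 * a ^ 2 * p t ≤ 4 * a ^ 2 * (2 * R t) := by gcongr
      gcongr
      linarith
    have h5 : 0 ≤ (μ - 2) * ((1 + t) * s t) := mul_nonneg (by linarith) (by positivity)
    have h6 : 0 ≤ (μ - 1) * ((1 + t) * r t) := mul_nonneg (by linarith) (by positivity)
    nlinarith
  have hle := hanti (mem_Ici.2 le_rfl) (mem_Ici.2 ht) ht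
  have haμ : a ≤ μ := by nlinarith
  have hR0 : R 0 ≤ 12 * μ ^ 2 * (p 0 + r 0) := by
    have h1 := h.abs_mul_q_le le_rfl (μ - 1) 1
    have h2 := le_abs_self ((μ - 1) * 1 * q 0)
    have h3 := h.s_le 0 le_rfl
    have hp := h.p_nonneg 0 le_rfl
    have hr := h.r_nonneg 0 le_rfl
    have h4 : 4 * a ^ 2 * p 0 ≤ 4 * μ ^ 2 * p 0 := by gcongr
    have h5 : (μ - 1) ^ 2 * p 0 ≤ μ ^ 2 * p 0 := by
      gcongr <;> linarith
    have h6 : r 0 ≤ μ ^ 2 * r 0 := by nlinarith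
    simp only [hR]
    nlinarith [mul_nonneg (sq_nonneg μ) hp]
  have hR0' : 0 ≤ R 0 := by
    have := hRp 0 le_rfl
    have := h.p_nonneg 0 le_rfl
    linarith
  have hG0 : G 0 ≤ R 0 := by
    simp only [hG]
    refine mul_le_of_le_one_left hR0' (Real.exp_le_one_iff.2 ?_)
    have : 0 ≤ 8 * a ^ 2 * (1 + 0) ^ 2 := by positivity
    linarith
  have hexp : Real.exp (8 * a ^ 2 * (1 + t) ^ 2) ≤ Real.exp (8 * μ ^ 2) := by
    refine Real.exp_le_exp.2 ?_
    have : (a * (1 + t)) ^ 2 ≤ μ ^ 2 := by gcongr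
    nlinarith
  calc (1 + t) ^ 2 * (r t + s t) ≤ R t := hRr t ht
    _ = Real.exp (8 * a ^ 2 * (1 + t) ^ 2) * G t := by
      simp only [hG]
      rw [← mul_assoc, ← Real.exp_add]
      simp
    _ ≤ Real.exp (8 * a ^ 2 * (1 + t) ^ 2) * R 0 := by gcongr; exact hle.trans hG0
    _ ≤ Real.exp (8 * μ ^ 2) * (12 * μ ^ 2 * (p 0 + r 0)) := by gcongr
    _ = _ := by ring

/-- The decay estimate in the zone of high frequencies, `μ ≤ a (1 + t)`. -/
lemma high_zone (h : EnergyData μ a p q r s w) (hμ : 2 < μ) (ha : 0 < a) {t₀ t : ℝ} (ht₀ : 0 ≤ t₀)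
    (hat : μ ≤ a * (1 + t₀)) (htt : t₀ ≤ t) :
    (1 + t) ^ μ * (r t + s t) ≤ Real.exp 1 * 6 * ((1 + t₀) ^ μ * (r t₀ + s t₀)) := by
  -- (1+t)^μ F is the energy of v = (1+t)^(μ/2) x, which solves v'' + (k² - μ(μ-2)/(4(1+t)²)) v = 0.
  -- Only the time dependence of the potential changes it, whence the remainder c p/(1+t)³ in `hdF`.
  set F : ℝ → ℝ := fun t => r t + s t + μ * (q t / (1 + t)) + μ / 2 * (p t / (1 + t) ^ 2) with hF
  have hp_le : ∀ t, t₀ ≤ t → μ ^ 2 * (p t / (1 + t) ^ 2) ≤ s t := by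
    intro t ht
    have h0 : 0 ≤ t := ht₀.trans ht
    have h1 := h.le_s t h0
    have h2 : μ ^ 2 ≤ (a * (1 + t)) ^ 2 := by
      have : a * (1 + t₀) ≤ a * (1 + t) := by gcongr
      gcongr
      linarith
    refine le_trans ?_ h1
    rw [mul_div_assoc', div_le_iff₀ (by positivity)]
    nlinarith [mul_le_mul_of_nonneg_right h2 (h.p_nonneg t h0)]
  have hq_le : ∀ t, t₀ ≤ t → |μ * (q t / (1 + t))| ≤ (r t + s t) / 2 := by
    intro t ht
    have h0 : 0 ≤ t := ht₀.trans ht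
    have h1 := h.abs_mul_q_le h0 (μ / (1 + t)) 1
    have h2 := hp_le t ht
    have e : μ / (1 + t) * 1 * q t = μ * (q t / (1 + t)) := by ring
    have e' : (μ / (1 + t)) ^ 2 * p t = μ ^ 2 * (p t / (1 + t) ^ 2) := by rw [div_pow]; ring
    rw [e, e'] at h1
    linarith
  have hp0 : ∀ t, t₀ ≤ t → 0 ≤ p t / (1 + t) ^ 2 := fun t ht =>
    div_nonneg (h.p_nonneg t (ht₀.trans ht)) (sq_nonneg _)
  have hF_ge : ∀ t, t₀ ≤ t → (r t + s t) / 2 ≤ F t := by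
    intro t ht
    have h1 := neg_abs_le (μ * (q t / (1 + t)))
    have h2 := hq_le t ht
    have h3 : 0 ≤ μ / 2 * (p t / (1 + t) ^ 2) := mul_nonneg (by linarith) (hp0 t ht)
    simp only [hF]
    linarith
  have hF_le : F t₀ ≤ 3 * (r t₀ + s t₀) := by
    have h1 := le_abs_self (μ * (q t₀ / (1 + t₀)))
    have h2 := hq_le t₀ le_rfl
    have h3 := hp_le t₀ le_rfl
    have h4 := hp0 t₀ le_rfl
    have h5 := h.r_nonneg t₀ ht₀
    have h6 := h.s_nonneg ht₀
    have h7 : μ / 2 * (p t₀ / (1 + t₀) ^ 2) ≤ μ ^ 2 * (p t₀ / (1 + t₀) ^ 2) := by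
      gcongr
      nlinarith
    simp only [hF]
    linarith
  set c : ℝ := μ ^ 2 / 2 - μ with hc
  have hc0 : 0 ≤ c := by nlinarith
  have hdF : ∀ t, t₀ < t → HasDerivAt F (-(μ / (1 + t)) * F t + c * (p t / (1 + t) ^ 3)) t := by
    intro t ht
    have h0 : 0 < t := ht₀.trans_lt ht
    have hne : 1 + t ≠ 0 := by positivity
    have hτ : HasDerivAt (fun t : ℝ => 1 + t) 1 t := (hasDerivAt_id t).const_add 1
    refine HasDerivAt.congr_deriv ((((h.deriv_r t h0).add (h.deriv_s t h0)).add
      (((h.deriv_q t h0).div hτ hne).const_mul μ)).add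
      (((h.deriv_p t h0).div (hτ.pow 2) (pow_ne_zero 2 hne)).const_mul (μ / 2))) ?_
    simp only [hF, hc, Pi.pow_apply]
    push_cast
    field_simp
    ring
  -- As p ≤ 2F/a², the remainder has relative size at most 2c/(a²(1+t)³). The exponential integrates
  -- this rate, and its exponent is at most 1 from t₀ on.
  set G : ℝ → ℝ := fun t => (1 + t) ^ μ * (Real.exp (c / (a ^ 2 * (1 + t) ^ 2)) * F t) with hG
  have hdG : ∀ t, t₀ < t → HasDerivAt G ((1 + t) ^ μ * (Real.exp (c / (a ^ 2 * (1 + t) ^ 2)) *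
      (c / (1 + t) ^ 3 * (p t - 2 / a ^ 2 * F t)))) t := by
    intro t ht
    have h0 : 0 < t := ht₀.trans_lt ht
    have hpos : 0 < 1 + t := by positivity
    have hτ : HasDerivAt (fun t : ℝ => 1 + t) 1 t := (hasDerivAt_id t).const_add 1
    have h1 : HasDerivAt (fun t : ℝ => (1 + t) ^ μ) (μ / (1 + t) * (1 + t) ^ μ) t := by
      refine (hτ.rpow_const (p := μ) (Or.inl hpos.ne')).congr_deriv ?_
      rw [Real.rpow_sub_one hpos.ne']
      field_simp
    have h2 : HasDerivAt (fun t : ℝ => c / (a ^ 2 * (1 + t) ^ 2))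
        (-(2 * c / (a ^ 2 * (1 + t) ^ 3))) t := by
      refine ((hasDerivAt_const t c).div ((hτ.pow 2).const_mul (a ^ 2))
        (mul_ne_zero (by positivity) (pow_ne_zero 2 hpos.ne'))).congr_deriv ?_
      simp only [Pi.pow_apply]
      push_cast
      field_simp
      ring
    refine (h1.mul (h2.exp.mul (hdF t ht))).congr_deriv ?_
    simp only [Pi.mul_apply]
    field_simp
    ring
  have hcF : ContinuousOn F (Ici t₀) := by
    have hsub : Ici t₀ ⊆ Ici (0 : ℝ) := Ici_subset_Ici.2 ht₀
    have := h.cont_p.mono hsub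
    have := h.cont_q.mono hsub
    have := h.cont_r.mono hsub
    have := h.cont_s.mono hsub
    have hne : ∀ t ∈ Ici t₀, 1 + t ≠ 0 := fun t ht => by
      have : 0 ≤ t := hsub ht
      positivity
    have hne2 : ∀ t ∈ Ici t₀, (1 + t) ^ 2 ≠ 0 := fun t ht => pow_ne_zero 2 (hne t ht)
    fun_prop (disch := assumption)
  have hcG : ContinuousOn G (Ici t₀) := by
    have hsub : Ici t₀ ⊆ Ici (0 : ℝ) := Ici_subset_Ici.2 ht₀
    have hne : ∀ t ∈ Ici t₀, 1 + t ≠ 0 := fun t ht => by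
      have : 0 ≤ t := hsub ht
      positivity
    have hne2 : ∀ t ∈ Ici t₀, a ^ 2 * (1 + t) ^ 2 ≠ 0 := fun t ht =>
      mul_ne_zero (by positivity) (pow_ne_zero 2 (hne t ht))
    refine ContinuousOn.mul ?_ (ContinuousOn.mul ?_ hcF)
    · exact ContinuousOn.rpow_const (by fun_prop) fun t ht => Or.inl (hne t ht)
    · fun_prop (disch := assumption)
  have hanti : AntitoneOn G (Ici t₀) := by
    refine antitoneOn_Ici_of_hasDerivAt_nonpos hcG hdG fun t ht => ?_
    have h0 : 0 < t := ht₀.trans_lt ht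
    have h1 := hF_ge t ht.le
    have h2 := h.le_s t h0.le
    have h3 := h.r_nonneg t h0.le
    refine mul_nonpos_of_nonneg_of_nonpos (by positivity) (mul_nonpos_of_nonneg_of_nonpos
      (Real.exp_pos _).le (mul_nonpos_of_nonneg_of_nonpos (by positivity) ?_))
    rw [sub_nonpos, div_mul_eq_mul_div, le_div_iff₀ (by positivity)]
    linarith
  have hle := hanti (mem_Ici.2 le_rfl) (mem_Ici.2 htt) htt
  have ht : 0 ≤ t := ht₀.trans htt
  have hE : 0 ≤ r t₀ + s t₀ := add_nonneg (h.r_nonneg t₀ ht₀) (h.s_nonneg ht₀)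
  have hFt : 0 ≤ F t :=
    le_trans (by have := h.r_nonneg t ht; have := h.s_nonneg ht; positivity) (hF_ge t htt)
  have hexp₀ : Real.exp (c / (a ^ 2 * (1 + t₀) ^ 2)) ≤ Real.exp 1 := by
    refine Real.exp_le_exp.2 ((div_le_one (by positivity)).2 ?_)
    have : μ ^ 2 ≤ (a * (1 + t₀)) ^ 2 := by gcongr
    nlinarith
  have hexp : 1 ≤ Real.exp (c / (a ^ 2 * (1 + t) ^ 2)) := Real.one_le_exp (by positivity)
  calc (1 + t) ^ μ * (r t + s t) ≤ (1 + t) ^ μ * (2 * F t) := by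
        gcongr
        linarith [hF_ge t htt]
    _ ≤ 2 * G t := by
        have : F t ≤ Real.exp (c / (a ^ 2 * (1 + t) ^ 2)) * F t := le_mul_of_one_le_left hFt hexp
        have : (1 + t) ^ μ * F t ≤ G t := by
          simp only [hG]
          gcongr
        linarith
    _ ≤ 2 * G t₀ := by gcongr
    _ ≤ 2 * ((1 + t₀) ^ μ * (Real.exp 1 * F t₀)) := by
        simp only [hG]
        have := hF_ge t₀ le_rfl
        have : 0 ≤ F t₀ := by linarith
        gcongr
    _ ≤ 2 * ((1 + t₀) ^ μ * (Real.exp 1 * (3 * (r t₀ + s t₀)))) := by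
        gcongr
    _ = _ := by ring

/-- The constant in the decay estimate on a frequency shell. -/
noncomputable def _root_.DissipativeWave.decayConst (μ κ : ℝ) : ℝ :=
  Real.exp 1 * 6 * (Real.exp (8 * μ ^ 2) * (12 * μ ^ 2)) * (2 * μ) ^ (2 * κ)

/-- The decay of the energy on a frequency shell, in terms of weighted data. -/
lemma decay (h : EnergyData μ a p q r s w) (hμ : 2 < μ) {κ θ d : ℝ} (hκ : 0 ≤ κ) (ha : 0 ≤ a)
    (hd : 0 ≤ d) (hθ₁ : θ ≤ 1 + κ) (hθ₂ : 2 * θ ≤ μ) (hlow : p 0 + r 0 ≤ (2 * a) ^ (2 * κ) * d)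
    (hhigh : r 0 + s 0 ≤ d) {t : ℝ} (ht : 0 ≤ t) :
    r t + s t ≤ decayConst μ κ * d * (1 + t) ^ (-(2 * θ)) := by
  have hτ : 0 < 1 + t := by positivity
  have hτ1 : 1 ≤ 1 + t := by linarith
  have he : 1 ≤ Real.exp 1 * 6 := by linarith [Real.add_one_le_exp 1]
  set C₀ := Real.exp (8 * μ ^ 2) * (12 * μ ^ 2) with hC₀
  have hC₀1 : 1 ≤ C₀ := by
    have h1 : 1 ≤ Real.exp (8 * μ ^ 2) := Real.one_le_exp (by positivity)
    have h2 : 1 ≤ 12 * μ ^ 2 := by nlinarith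
    exact one_le_mul_of_one_le_of_one_le h1 h2
  have hM1 : 1 ≤ (2 * μ) ^ (2 * κ) := Real.one_le_rpow (by linarith) (by positivity)
  have hlow_est : ∀ t, 0 ≤ t → a * (1 + t) ≤ μ →
      r t + s t ≤ C₀ * ((2 * a) ^ (2 * κ) * d) / (1 + t) ^ 2 := by
    intro t ht hat
    rw [le_div_iff₀ (by positivity), mul_comm]
    exact (h.low_zone hμ ha ht hat).trans (by gcongr)
  rcases le_total (a * (1 + t)) μ with hat | hat
  · calc r t + s t ≤ C₀ * ((2 * a) ^ (2 * κ) * d) / (1 + t) ^ 2 := hlow_est t ht hat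
      _ ≤ C₀ * (((2 * μ) ^ (2 * κ) * (1 + t) ^ (-(2 * κ))) * d) / (1 + t) ^ 2 := by
        have : (2 * a) ^ (2 * κ) ≤ (2 * μ) ^ (2 * κ) * (1 + t) ^ (-(2 * κ)) := by
          rw [Real.rpow_neg hτ.le, ← div_eq_mul_inv, ← Real.div_rpow (by positivity) hτ.le]
          refine Real.rpow_le_rpow (by positivity) ?_ (by positivity)
          rw [le_div_iff₀ hτ]
          linarith
        gcongr
      _ = C₀ * (2 * μ) ^ (2 * κ) * d * (1 + t) ^ (-(2 * κ) - 2) := by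
        rw [Real.rpow_sub hτ, Real.rpow_two]
        ring
      _ ≤ C₀ * (2 * μ) ^ (2 * κ) * d * (1 + t) ^ (-(2 * θ)) := by
        have : (1 + t) ^ (-(2 * κ) - 2) ≤ (1 + t) ^ (-(2 * θ)) :=
          Real.rpow_le_rpow_of_exponent_le hτ1 (by linarith)
        gcongr
      _ ≤ Real.exp 1 * 6 * (C₀ * (2 * μ) ^ (2 * κ) * d * (1 + t) ^ (-(2 * θ))) :=
        le_mul_of_one_le_left (by positivity) he
      _ = _ := by rw [decayConst]; ring
  · have ha0 : 0 < a := by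
      by_contra! h0
      nlinarith
    rcases le_total μ a with haμ | haμ
    · have h1 := h.high_zone hμ ha0 le_rfl (by simpa using haμ) ht
      simp only [add_zero, Real.one_rpow, one_mul] at h1
      calc r t + s t = (1 + t) ^ (-μ) * ((1 + t) ^ μ * (r t + s t)) := by
            rw [← mul_assoc, ← Real.rpow_add hτ]
            simp
        _ ≤ (1 + t) ^ (-(2 * θ)) * (Real.exp 1 * 6 * d) := by
          have : (1 + t) ^ (-μ) ≤ (1 + t) ^ (-(2 * θ)) :=
            Real.rpow_le_rpow_of_exponent_le hτ1 (by linarith)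
          have h0 := h.r_nonneg t ht
          have h0' := h.s_nonneg ht
          refine mul_le_mul this (h1.trans ?_) (by positivity) (by positivity)
          gcongr
        _ ≤ (1 + t) ^ (-(2 * θ)) * (Real.exp 1 * 6 * d) * (C₀ * (2 * μ) ^ (2 * κ)) :=
          le_mul_of_one_le_right (by positivity) (one_le_mul_of_one_le_of_one_le hC₀1 hM1)
        _ = _ := by rw [decayConst]; ring
    -- The low zone ends at t₀, where 1 + t₀ = μ/a = b⁻¹; the bound reached there is the starting
    -- value for the high zone.
    · set b := a / μ with hb
      have hμ0 : 0 < μ := by linarith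
      have hb0 : 0 < b := by positivity
      have hb1 : b ≤ 1 := (div_le_one hμ0).2 haμ
      set t₀ := μ / a - 1 with ht₀
      have hτ₀ : 1 + t₀ = b⁻¹ := by rw [hb, ht₀, inv_div]; ring
      have ht₀0 : 0 ≤ t₀ := by
        rw [ht₀, sub_nonneg]
        exact (one_le_div ha0).2 haμ
      have haτ₀ : a * (1 + t₀) = μ := by rw [ht₀]; field_simp; ring
      have htt : t₀ ≤ t := by
        by_contra! hlt
        nlinarith
      have h1 := h.high_zone hμ ha0 ht₀0 haτ₀.ge htt
      have h2 := hlow_est t₀ ht₀0 haτ₀.le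
      rw [hτ₀] at h1 h2
      have hbτ : 1 ≤ b * (1 + t) := by
        rw [hb, div_mul_eq_mul_div]
        exact (one_le_div hμ0).2 hat
      have h2a : (2 * a) ^ (2 * κ) = (2 * μ) ^ (2 * κ) * b ^ (2 * κ) := by
        rw [← Real.mul_rpow (by positivity) hb0.le, hb]
        congr 1
        field_simp
      have hE : 0 ≤ r t₀ + s t₀ := add_nonneg (h.r_nonneg t₀ ht₀0) (h.s_nonneg ht₀0)
      calc r t + s t = (1 + t) ^ (-μ) * ((1 + t) ^ μ * (r t + s t)) := by
            rw [← mul_assoc, ← Real.rpow_add hτ]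
            simp
        _ ≤ (1 + t) ^ (-μ) * (Real.exp 1 * 6 * (b⁻¹ ^ μ * (r t₀ + s t₀))) := by gcongr
        _ = Real.exp 1 * 6 * (b * (1 + t)) ^ (-μ) * (r t₀ + s t₀) := by
          rw [Real.mul_rpow hb0.le hτ.le, Real.inv_rpow hb0.le, Real.rpow_neg hb0.le]
          ring
        _ ≤ Real.exp 1 * 6 * (b * (1 + t)) ^ (-(2 * θ)) *
            (C₀ * ((2 * a) ^ (2 * κ) * d) / b⁻¹ ^ 2) := by
          -- Since b(1+t) ≥ 1, the exponent -μ may be weakened to -2θ. The leftover power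
          -- b^(2κ+2-2θ) is at most 1 because b ≤ 1 and θ ≤ 1 + κ.
          have : (b * (1 + t)) ^ (-μ) ≤ (b * (1 + t)) ^ (-(2 * θ)) :=
            Real.rpow_le_rpow_of_exponent_le hbτ (by linarith)
          gcongr
        _ = Real.exp 1 * 6 * C₀ * (2 * μ) ^ (2 * κ) * d * (1 + t) ^ (-(2 * θ)) *
            b ^ (-(2 * θ) + 2 * κ + 2) := by
          rw [Real.mul_rpow hb0.le hτ.le, h2a, Real.rpow_add hb0, Real.rpow_add hb0, Real.rpow_two]
          field_simp
        _ ≤ Real.exp 1 * 6 * C₀ * (2 * μ) ^ (2 * κ) * d * (1 + t) ^ (-(2 * θ)) * 1 := by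
          have : b ^ (-(2 * θ) + 2 * κ + 2) ≤ 1 :=
            Real.rpow_le_one hb0.le hb1 (by linarith)
          gcongr
        _ = _ := by rw [decayConst]; ring

end EnergyData

/-! ### Oscillators in a Hilbert space -/

section Hilbert

variable {H : Type*} [NormedAddCommGroup H] [InnerProductSpace ℂ H]

lemma re_inner_self (x : H) : (inner ℂ x x).re = ‖x‖ ^ 2 := by
  have := inner_self_eq_norm_sq (𝕜 := ℂ) x
  simpa using this

lemma re_inner_comm (x y : H) : (inner ℂ x y).re = (inner ℂ y x).re := by
  have := inner_re_symm (𝕜 := ℂ) x y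
  simpa using this

variable [NormedSpace ℝ H]

lemma hasDerivAt_re_inner {f g : ℝ → H} {f' g' : H} {t : ℝ} (hf : HasDerivAt f f' t)
    (hg : HasDerivAt g g' t) :
    HasDerivAt (fun t => (inner ℂ (f t) (g t)).re)
      ((inner ℂ (f t) g').re + (inner ℂ f' (g t)).re) t := by
  exact (Complex.reCLM.hasFDerivAt.comp_hasDerivAt t (hf.inner ℂ hg)).congr_deriv (by simp)

/-- The quadratic quantities of a solution of `x'' + L² x + μ/(1+t) x' = 0` in a Hilbert space. -/
lemma energyData_of_hasDerivAt {μ a : ℝ} {x y : ℝ → H} (L : H →L[ℂ] H)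
    (hL : ∀ v w, inner ℂ (L v) w = inner ℂ v (L w))
    (hcx : ContinuousOn x (Ici 0)) (hcy : ContinuousOn y (Ici 0))
    (hx : ∀ t, 0 < t → HasDerivAt x (y t) t)
    (hy : ∀ t, 0 < t → HasDerivAt y (-L (L (x t)) - ((μ / (1 + t) : ℝ) : ℂ) • y t) t)
    (hle : ∀ t, 0 ≤ t → a ^ 2 * ‖x t‖ ^ 2 ≤ ‖L (x t)‖ ^ 2)
    (hge : ∀ t, 0 ≤ t → ‖L (x t)‖ ^ 2 ≤ 4 * a ^ 2 * ‖x t‖ ^ 2)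
    (hLd : ∀ t, 0 < t → HasDerivAt (fun t => L (x t)) (L (y t)) t) :
    EnergyData μ a (fun t => ‖x t‖ ^ 2) (fun t => (inner ℂ (x t) (y t)).re)
      (fun t => ‖y t‖ ^ 2) (fun t => ‖L (x t)‖ ^ 2)
      (fun t => (inner ℂ (L (x t)) (L (y t))).re) where
  cont_p := by fun_prop
  cont_q := Complex.continuous_re.comp_continuousOn (hcx.inner hcy)
  cont_r := by fun_prop
  cont_s := (L.continuous.comp_continuousOn hcx).norm.pow 2
  deriv_p t ht := by
    have := hasDerivAt_re_inner (hx t ht) (hx t ht)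
    simp only [re_inner_self] at this
    rw [re_inner_comm (y t) (x t), ← two_mul] at this
    exact this
  deriv_q t ht := by
    refine (hasDerivAt_re_inner (hx t ht) (hy t ht)).congr_deriv ?_
    rw [inner_sub_right, inner_neg_right, ← hL, inner_smul_right]
    simp only [Complex.sub_re, Complex.neg_re, Complex.re_ofReal_mul, re_inner_self]
    ring
  deriv_r t ht := by
    have := hasDerivAt_re_inner (hy t ht) (hy t ht)
    simp only [re_inner_self] at this
    refine this.congr_deriv ?_
    rw [re_inner_comm _ (y t), inner_sub_right, inner_neg_right, ← hL, inner_smul_right,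
      re_inner_comm (L (x t))]
    simp only [Complex.sub_re, Complex.neg_re, Complex.re_ofReal_mul, re_inner_self]
    ring
  deriv_s t ht := by
    have := hasDerivAt_re_inner (hLd t ht) (hLd t ht)
    simp only [re_inner_self] at this
    rw [re_inner_comm (L (y t)), ← two_mul] at this
    exact this
  p_nonneg t _ := sq_nonneg _
  r_nonneg t _ := sq_nonneg _
  sq_le t _ := by
    rw [← mul_pow, sq_le_sq, abs_of_nonneg (a := ‖x t‖ * ‖y t‖) (by positivity)]
    exact (Complex.abs_re_le_norm _).trans (norm_inner_le_norm _ _)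
  le_s := hle
  s_le := hge

end Hilbert

/-! ### Bounded multipliers on L² -/

noncomputable section

/-- The symbol `m` is (essentially) bounded. -/
abbrev BoundedSymbol {n : ℕ} (m : EuclideanSpace ℝ (Fin n) → ℝ) : Prop :=
  MemLp (fun ξ => (m ξ : ℂ)) ⊤ (volume : Measure (EuclideanSpace ℝ (Fin n)))

/-- Multiplication by a bounded real function, as a bounded operator on `L²`. -/
def mulOp {n : ℕ} (m : EuclideanSpace ℝ (Fin n) → ℝ)
    (hm : BoundedSymbol m) : L2 n →L[ℂ] L2 n :=
  (ContinuousLinearMap.lsmul ℂ ℂ).holderL volume ⊤ 2 2 hm.toLp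

variable {n : ℕ} {m m₁ m₂ : EuclideanSpace ℝ (Fin n) → ℝ}

lemma coeFn_mulOp (hm : BoundedSymbol m) (f : L2 n) :
    mulOp m hm f =ᵐ[volume] fun ξ => (m ξ : ℂ) * f ξ := by
  have h := (ContinuousLinearMap.lsmul ℂ ℂ).coeFn_holder (r := 2) (hm.toLp (fun ξ => (m ξ : ℂ))) f
  filter_upwards [h, hm.coeFn_toLp] with ξ h1 h2
  refine h1.trans ?_
  rw [h2]
  simp

lemma mulOp_mulOp (h₁ : BoundedSymbol m₁)
    (h₂ : BoundedSymbol m₂) (h : BoundedSymbol m)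
    (hm : ∀ ξ, m₁ ξ * m₂ ξ = m ξ) (f : L2 n) :
    mulOp m₁ h₁ (mulOp m₂ h₂ f) = mulOp m h f := by
  refine Lp.ext ?_
  filter_upwards [coeFn_mulOp h₁ (mulOp m₂ h₂ f), coeFn_mulOp h₂ f, coeFn_mulOp h f]
    with ξ e1 e2 e3
  rw [e1, e2, e3, ← hm ξ]
  push_cast
  ring

/-- The symbol is real, so it passes through the conjugation in the inner product. -/
lemma inner_mulOp (hm : BoundedSymbol m) (f g : L2 n) :
    inner ℂ (mulOp m hm f) g = inner ℂ f (mulOp m hm g) := by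
  rw [L2.inner_def, L2.inner_def]
  refine integral_congr_ae ?_
  filter_upwards [coeFn_mulOp hm f, coeFn_mulOp hm g] with ξ e1 e2
  rw [e1, e2]
  simp
  ring

lemma memLp_top_of_abs_le (hm : Measurable m) (C : ℝ) (hC : ∀ ξ, |m ξ| ≤ C) :
    BoundedSymbol m :=
  memLp_top_of_bound (Complex.measurable_ofReal.comp hm).aestronglyMeasurable C
    (Filter.Eventually.of_forall fun ξ => by simpa using hC ξ)

/-! ### From weak to strong derivatives -/

/-- An `L²` function is determined by the tempered distribution that it defines. -/
lemma toTemperedDistribution_injective :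
    Function.Injective (Lp.toTemperedDistribution : L2 n → _) := by
  have := LinearMap.ker_eq_bot.1 (Lp.ker_toTemperedDistributionCLM_eq_bot (F := ℂ)
    (μ := (volume : Measure (EuclideanSpace ℝ (Fin n)))) (p := 2))
  exact this

/-- The pairing of an `L²` function with a Schwartz function, as a functional on `L²`. -/
def pairing (θ : 𝓢(EuclideanSpace ℝ (Fin n), ℂ)) : L2 n →L[ℂ] ℂ :=
  ((ContinuousLinearMap.lsmul ℂ ℂ).flip.lpPairing volume 2 2).flip (θ.toLp 2 volume)

lemma pairing_apply (θ : 𝓢(EuclideanSpace ℝ (Fin n), ℂ)) (f : L2 n) :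
    pairing θ f = Lp.toTemperedDistribution f θ := by
  rw [Lp.toTemperedDistribution_apply, pairing, ContinuousLinearMap.flip_apply,
    ContinuousLinearMap.lpPairing_eq_integral]
  refine integral_congr_ae ?_
  filter_upwards [θ.coeFn_toLp 2 volume] with x hx
  simp [hx]

lemma eq_of_forall_pairing_eq {f g : L2 n} (h : ∀ θ, pairing θ f = pairing θ g) : f = g := by
  refine toTemperedDistribution_injective ?_
  ext θ
  rw [← pairing_apply, ← pairing_apply, h]

/-- A curve in `L²` that is weakly differentiable on `(0, ∞)`, with a continuous derivative, is
differentiable. -/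
lemma hasDerivAt_of_weak {X Y : ℝ → L2 n} (hY : ContinuousOn Y (Ioi 0))
    (h : ∀ θ t, 0 < t → HasDerivAt (fun s => pairing θ (X s)) (pairing θ (Y t)) t)
    {t : ℝ} (ht : 0 < t) : HasDerivAt X (Y t) t := by
  -- The pairings of X - Z have zero derivative, hence are constant; as pairings separate points of
  -- L², X and the primitive Z of Y differ by a constant.
  set Z : ℝ → L2 n := fun s => ∫ τ in t..s, Y τ with hZ
  have hsub : ∀ s, 0 < s → uIcc t s ⊆ Ioi 0 := fun s hs =>
    (convex_Ioi (0 : ℝ)).ordConnected.uIcc_subset ht hs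
  have hZd : ∀ s, 0 < s → HasDerivAt Z (Y s) s := fun s hs =>
    intervalIntegral.integral_hasDerivAt_right ((hY.mono (hsub s hs)).intervalIntegrable)
      (hY.stronglyMeasurableAtFilter isOpen_Ioi s hs) (hY.continuousAt (Ioi_mem_nhds hs))
  have hXZ : ∀ s, 0 < s → X s = X t + Z s := by
    intro s hs
    refine eq_of_forall_pairing_eq fun θ => ?_
    have hd : ∀ r ∈ Ioi (0 : ℝ), HasDerivAt (fun s => pairing θ (X s) - pairing θ (Z s)) 0 r := by
      intro r hr
      have h1 : HasDerivAt (fun s => pairing θ (Z s)) (pairing θ (Y r)) r :=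
        ((pairing θ).restrictScalars ℝ).hasFDerivAt.comp_hasDerivAt r (hZd r hr)
      exact ((h θ r hr).sub h1).congr_deriv (by simp)
    have := (convex_Ioi (0 : ℝ)).is_const_of_fderivWithin_eq_zero (𝕜 := ℝ)
      (f := fun s => pairing θ (X s) - pairing θ (Z s))
      (fun r hr => (hd r hr).differentiableAt.differentiableWithinAt)
      (fun r hr => by
        rw [fderivWithin_of_isOpen isOpen_Ioi hr]
        ext
        simp [(hd r hr).deriv]) (mem_Ioi.2 hs) (mem_Ioi.2 ht)
    simp only [hZ, intervalIntegral.integral_same, map_zero, sub_zero] at this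
    rw [map_add, ← this]
    simp [hZ]
  refine ((hZd t ht).const_add (X t)).congr_of_eventuallyEq ?_
  filter_upwards [Ioi_mem_nhds ht] with s hs using hXZ s hs

/-! ### The equation divided by 1 + |ξ|² -/

/-- The weight `(1 + |ξ|²)⁻¹`. -/
def resolventWeight (ξ : EuclideanSpace ℝ (Fin n)) : ℝ := (1 + ‖ξ‖ ^ 2)⁻¹

lemma resolventWeight_pos (ξ : EuclideanSpace ℝ (Fin n)) : 0 < resolventWeight ξ := by
  rw [resolventWeight]
  positivity

lemma memLp_resolventWeight :
    BoundedSymbol (resolventWeight (n := n)) := by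
  refine memLp_top_of_abs_le (by unfold resolventWeight; fun_prop) 1 fun ξ => ?_
  rw [abs_of_pos (resolventWeight_pos ξ), resolventWeight]
  exact inv_le_one_of_one_le₀ (by nlinarith [sq_nonneg ‖ξ‖])

/-- The weight has the order of the Laplacian, so that after the division Δu lies in L² for every u
in L². -/
lemma memLp_sq_mul_resolventWeight :
    BoundedSymbol fun ξ : EuclideanSpace ℝ (Fin n) =>
      (2 * Real.pi * ‖ξ‖) ^ 2 * resolventWeight ξ := by
  refine memLp_top_of_abs_le (m := fun ξ => (2 * Real.pi * ‖ξ‖) ^ 2 * resolventWeight ξ)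
    (by unfold resolventWeight; fun_prop) ((2 * Real.pi) ^ 2) fun ξ => ?_
  have h0 := (resolventWeight_pos ξ).le
  rw [abs_of_nonneg (by positivity), mul_pow, mul_assoc]
  refine mul_le_of_le_one_right (by positivity) ?_
  rw [resolventWeight, ← div_eq_mul_inv, div_le_one (by positivity)]
  linarith

lemma hasTemperateGrowth_resolventWeight :
    Function.HasTemperateGrowth
      (fun ξ : EuclideanSpace ℝ (Fin n) => (resolventWeight ξ : ℂ)) := by
  have h := Function.hasTemperateGrowth_one_add_norm_sq_rpow (EuclideanSpace ℝ (Fin n)) (-1)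
  simp only [Real.rpow_neg_one] at h
  unfold resolventWeight
  fun_prop

/-- Testing `m(ξ) 𝓕 f` with `θ` amounts to testing `f` with `𝓕 (m θ)`. -/
lemma pairing_mulOp_fourier (hm : BoundedSymbol m)
    {θ ψ : 𝓢(EuclideanSpace ℝ (Fin n), ℂ)} (hψ : ∀ ξ, ψ ξ = (m ξ : ℂ) * θ ξ) (f : L2 n) :
    pairing θ (mulOp m hm (𝓕 f)) = Lp.toTemperedDistribution f (𝓕 ψ) := by
  rw [← TemperedDistribution.fourier_apply, Lp.fourier_toTemperedDistribution_eq, pairing_apply,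
    Lp.toTemperedDistribution_apply, Lp.toTemperedDistribution_apply]
  refine integral_congr_ae ?_
  filter_upwards [coeFn_mulOp hm (𝓕 f)] with ξ h1
  rw [h1, hψ]
  simp
  ring

/-- The Fourier transform of the Laplacian of `f`, tested with a Schwartz function. -/
lemma laplacian_apply_fourier (f : L2 n)
    {θ ψ : 𝓢(EuclideanSpace ℝ (Fin n), ℂ)} (hψ : ∀ ξ, ψ ξ = (resolventWeight ξ : ℂ) * θ ξ) :
    Δ (Lp.toTemperedDistribution f) (𝓕 ψ) =
      -pairing θ (mulOp _ memLp_sq_mul_resolventWeight (𝓕 f)) := by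
  have hg : Function.HasTemperateGrowth
      (fun ξ : EuclideanSpace ℝ (Fin n) => ((‖ξ‖ ^ 2 : ℝ) : ℂ)) := by fun_prop
  rw [TemperedDistribution.laplacian_eq_fourierMultiplierCLM,
    pairing_mulOp_fourier memLp_sq_mul_resolventWeight
      (ψ := ((2 * Real.pi) ^ 2 : ℂ) • SchwartzMap.smulLeftCLM ℂ (fun ξ => ((‖ξ‖ ^ 2 : ℝ) : ℂ)) ψ)]
  · simp only [TemperedDistribution.fourierMultiplierCLM_apply]
    rw [FourierTransform.fourier_smul, map_smul]
    simp only [smul_apply, TemperedDistribution.fourierInv_apply,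
      TemperedDistribution.smulLeftCLM_apply_apply, TemperedDistribution.fourier_apply]
    simp
  · intro ξ
    rw [smul_apply, SchwartzMap.smulLeftCLM_apply_apply hg, hψ]
    simp
    ring

end

noncomputable section

variable {n : ℕ}

lemma fourier_hasDerivAt {u : ℝ → L2 n} {v : L2 n} {t : ℝ} (h : HasDerivAt u v t) :
    HasDerivAt (fun t => (𝓕 (u t) : L2 n)) (𝓕 v) t :=
  ((FourierTransform.fourierCLM ℂ (L2 n) (F := L2 n)).restrictScalars ℝ).hasFDerivAt.comp_hasDerivAt
    t h

lemma mulOp_hasDerivAt {m : EuclideanSpace ℝ (Fin n) → ℝ}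
    (hm : BoundedSymbol m) {u : ℝ → L2 n} {v : L2 n} {t : ℝ}
    (h : HasDerivAt u v t) : HasDerivAt (fun t => mulOp m hm (u t)) (mulOp m hm v) t :=
  ((mulOp m hm).restrictScalars ℝ).hasFDerivAt.comp_hasDerivAt t h

namespace IsSolution

variable {μ : ℝ} {u₁ u₂ : L2 n} {u : ℝ → L2 n}

lemma hasDerivAt (h : IsSolution μ u₁ u₂ u) {t : ℝ} (ht : 0 < t) :
    HasDerivAt u (timeDeriv u t) t := by
  have hd := (contDiffOn_one_iff_derivWithin (uniqueDiffOn_Ici 0)).1 h.contDiffOn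
  exact (hd.1 t ht.le).hasDerivWithinAt.hasDerivAt (Ici_mem_nhds ht)

lemma continuousOn_fourier (h : IsSolution μ u₁ u₂ u) :
    ContinuousOn (fun t => (𝓕 (u t) : L2 n)) (Ici 0) :=
  (FourierTransform.fourierCLM ℂ (L2 n) (F := L2 n)).continuous.comp_continuousOn
    h.contDiffOn.continuousOn

lemma continuousOn_fourier_timeDeriv (h : IsSolution μ u₁ u₂ u) :
    ContinuousOn (fun t => (𝓕 (timeDeriv u t) : L2 n)) (Ici 0) :=
  (FourierTransform.fourierCLM ℂ (L2 n) (F := L2 n)).continuous.comp_continuousOn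
    ((contDiffOn_one_iff_derivWithin (uniqueDiffOn_Ici 0)).1 h.contDiffOn).2

/-- The wave equation on the Fourier side, after division by `1 + |ξ|²`. -/
lemma hasDerivAt_resolvent (h : IsSolution μ u₁ u₂ u) {t : ℝ} (ht : 0 < t) :
    HasDerivAt (fun t => mulOp _ memLp_resolventWeight (𝓕 (timeDeriv u t) : L2 n))
      (-mulOp _ memLp_sq_mul_resolventWeight (𝓕 (u t) : L2 n) -
        ((μ / (1 + t) : ℝ) : ℂ) • mulOp _ memLp_resolventWeight (𝓕 (timeDeriv u t) : L2 n)) t := by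
  refine hasDerivAt_of_weak (Y := fun t =>
      -mulOp _ memLp_sq_mul_resolventWeight (𝓕 (u t) : L2 n) -
        ((μ / (1 + t) : ℝ) : ℂ) • mulOp _ memLp_resolventWeight (𝓕 (timeDeriv u t) : L2 n))
    ?_ ?_ ht
  · have h1 := h.continuousOn_fourier.mono Ioi_subset_Ici_self
    have h2 := h.continuousOn_fourier_timeDeriv.mono Ioi_subset_Ici_self
    have h3 : ContinuousOn (fun t : ℝ => μ / (1 + t)) (Ioi 0) := by
      refine ContinuousOn.div (by fun_prop) (by fun_prop) fun t ht => ?_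
      have : (0 : ℝ) < t := ht
      positivity
    exact (((mulOp _ memLp_sq_mul_resolventWeight).continuous.comp_continuousOn h1).neg).sub
      ((Complex.continuous_ofReal.comp_continuousOn h3).smul
        ((mulOp _ memLp_resolventWeight).continuous.comp_continuousOn h2))
  · intro θ t ht
    -- Testing the equation with 𝓕 ψ moves both the Fourier transform and the weight onto the
    -- solution, so every term becomes a pairing of θ with an L² function.
    set ψ : 𝓢(EuclideanSpace ℝ (Fin n), ℂ) :=
      SchwartzMap.smulLeftCLM ℂ (fun ξ => (resolventWeight ξ : ℂ)) θ
    have hψ : ∀ ξ, ψ ξ = (resolventWeight ξ : ℂ) * θ ξ := fun ξ =>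
      SchwartzMap.smulLeftCLM_apply_apply hasTemperateGrowth_resolventWeight θ ξ
    have := h.equation t ht (𝓕 ψ)
    simp only [laplacian_apply_fourier _ hψ,
      ← pairing_mulOp_fourier memLp_resolventWeight hψ] at this
    refine this.congr_deriv ?_
    rw [map_sub, map_neg, map_smul, smul_eq_mul]

end IsSolution

/-! ### Localisation in frequency -/

/-- The length of the frequency, in the normalisation of Mathlib's Fourier transform. -/
def freq (ξ : EuclideanSpace ℝ (Fin n)) : ℝ := 2 * Real.pi * ‖ξ‖

lemma freq_nonneg (ξ : EuclideanSpace ℝ (Fin n)) : 0 ≤ freq ξ := by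
  unfold freq
  positivity

lemma measurable_freq : Measurable (freq : EuclideanSpace ℝ (Fin n) → ℝ) := by
  unfold freq
  fun_prop

lemma norm_two_pi_smul (ξ : EuclideanSpace ℝ (Fin n)) : ‖(2 * Real.pi) • ξ‖ = freq ξ := by
  rw [norm_smul, freq, Real.norm_of_nonneg (by positivity)]

lemma memLp_indicator {S : Set (EuclideanSpace ℝ (Fin n))} (hS : MeasurableSet S)
    {m : EuclideanSpace ℝ (Fin n) → ℝ} (hm : Measurable m) (C : ℝ) (hC0 : 0 ≤ C)
    (hC : ∀ ξ ∈ S, |m ξ| ≤ C) :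
    BoundedSymbol (S.indicator m) := by
  refine memLp_top_of_abs_le (hm.indicator hS) C fun ξ => ?_
  by_cases h : ξ ∈ S
  · simpa [h] using hC ξ h
  · simpa [h] using hC0

lemma coeFn_mulOp_indicator {S : Set (EuclideanSpace ℝ (Fin n))}
    {m : EuclideanSpace ℝ (Fin n) → ℝ}
    (h : BoundedSymbol (S.indicator m)) (f : L2 n) :
    mulOp (S.indicator m) h f =ᵐ[volume] S.indicator fun ξ => (m ξ : ℂ) * f ξ := by
  filter_upwards [coeFn_mulOp h f] with ξ h1
  rw [h1]
  by_cases hξ : ξ ∈ S <;> simp [hξ]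

lemma enorm_sq_eq_lintegral (f : L2 n) : ‖f‖ₑ ^ 2 = ∫⁻ ξ, ‖f ξ‖ₑ ^ 2 := by
  have := eLpNorm_nnreal_pow_eq_lintegral (μ := (volume : Measure (EuclideanSpace ℝ (Fin n))))
    (f := f) (p := 2) two_ne_zero
  rw [Lp.enorm_def]
  simpa only [NNReal.coe_ofNat, ENNReal.coe_ofNat, ENNReal.rpow_two] using this

lemma enorm_mulOp_indicator_sq {S : Set (EuclideanSpace ℝ (Fin n))} (hS : MeasurableSet S)
    {m : EuclideanSpace ℝ (Fin n) → ℝ}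
    (h : BoundedSymbol (S.indicator m)) (f : L2 n) :
    ‖mulOp (S.indicator m) h f‖ₑ ^ 2 = ∫⁻ ξ in S, ‖(m ξ : ℂ) * f ξ‖ₑ ^ 2 := by
  rw [enorm_sq_eq_lintegral, ← lintegral_indicator hS]
  refine lintegral_congr_ae ?_
  filter_upwards [coeFn_mulOp_indicator h f] with ξ h1
  rw [h1]
  by_cases hξ : ξ ∈ S <;> simp [hξ]

/-- A pointwise comparison on `S` gives a comparison of the norms of the localised functions. -/
lemma norm_mulOp_indicator_le {S : Set (EuclideanSpace ℝ (Fin n))}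
    {m₁ m₂ : EuclideanSpace ℝ (Fin n) → ℝ}
    (h₁ : BoundedSymbol (S.indicator m₁))
    (h₂ : BoundedSymbol (S.indicator m₂)) {f g : L2 n} {c : ℝ}
    (h : ∀ᵐ ξ, ξ ∈ S → ‖(m₁ ξ : ℂ) * f ξ‖ ≤ c * ‖(m₂ ξ : ℂ) * g ξ‖) :
    ‖mulOp (S.indicator m₁) h₁ f‖ ≤ c * ‖mulOp (S.indicator m₂) h₂ g‖ := by
  refine Lp.norm_le_mul_norm_of_ae_le_mul ?_
  filter_upwards [h, coeFn_mulOp_indicator h₁ f, coeFn_mulOp_indicator h₂ g] with ξ h e1 e2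
  rw [e1, e2]
  by_cases hξ : ξ ∈ S
  · simpa [hξ] using h hξ
  · simp [hξ]

/-- The solution, localised to a frequency shell, satisfies the energy relations. -/
lemma IsSolution.energyData {μ : ℝ} {u₁ u₂ : L2 n} {u : ℝ → L2 n} (h : IsSolution μ u₁ u₂ u)
    {S : Set (EuclideanSpace ℝ (Fin n))} (hS : MeasurableSet S) {a : ℝ} (ha : 0 ≤ a)
    (hSa : ∀ ξ ∈ S, a ≤ freq ξ ∧ freq ξ ≤ 2 * a)
    (h₁ : BoundedSymbol (S.indicator (fun _ => 1)))
    (hk : BoundedSymbol (S.indicator freq)) :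
    ∃ q w : ℝ → ℝ, EnergyData μ a
      (fun t => ‖mulOp _ h₁ (𝓕 (u t) : L2 n)‖ ^ 2) q
      (fun t => ‖mulOp _ h₁ (𝓕 (timeDeriv u t) : L2 n)‖ ^ 2)
      (fun t => ‖mulOp _ hk (𝓕 (u t) : L2 n)‖ ^ 2) w := by
  have hfreq : ∀ ξ : EuclideanSpace ℝ (Fin n), ‖ξ‖ ≤ freq ξ := fun ξ => by
    have : 1 ≤ 2 * Real.pi := by linarith [Real.pi_gt_three]
    exact le_mul_of_one_le_left (norm_nonneg _) this
  -- On S the factor 1 + |ξ|² is bounded, so the division by it can be undone.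
  have hM : BoundedSymbol
      (S.indicator (fun ξ => 1 + ‖ξ‖ ^ 2)) := by
    refine memLp_indicator hS (by fun_prop) (1 + (2 * a) ^ 2) (by positivity) fun ξ hξ => ?_
    rw [abs_of_nonneg (by positivity)]
    have := (hfreq ξ).trans (hSa ξ hξ).2
    gcongr
  have hkk : BoundedSymbol
      (S.indicator (fun ξ => freq ξ ^ 2)) := by
    refine memLp_indicator hS (measurable_freq.pow_const 2) ((2 * a) ^ 2) (by positivity)
      fun ξ hξ => ?_
    rw [abs_of_nonneg (by positivity)]
    have h0 := freq_nonneg ξ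
    have := (hSa ξ hξ).2
    gcongr
  have hkP : ∀ f : L2 n, mulOp _ hk (mulOp _ h₁ f) = mulOp _ hk f := fun f => by
    refine mulOp_mulOp hk h₁ hk (fun ξ => ?_) f
    by_cases hξ : ξ ∈ S <;> simp [hξ]
  have hMB : ∀ f : L2 n, mulOp _ hM (mulOp _ memLp_resolventWeight f) = mulOp _ h₁ f := fun f => by
    refine mulOp_mulOp hM memLp_resolventWeight h₁ (fun ξ => ?_) f
    have : 1 + ‖ξ‖ ^ 2 ≠ 0 := by positivity
    by_cases hξ : ξ ∈ S <;> simp [hξ, resolventWeight, this]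
  have hMK : ∀ f : L2 n, mulOp _ hM (mulOp _ memLp_sq_mul_resolventWeight f) = mulOp _ hkk f :=
    fun f => by
    refine mulOp_mulOp hM memLp_sq_mul_resolventWeight hkk (fun ξ => ?_) f
    have : 1 + ‖ξ‖ ^ 2 ≠ 0 := by positivity
    by_cases hξ : ξ ∈ S
    · simp [hξ, resolventWeight, freq]
      field_simp
    · simp [hξ]
  have hLL : ∀ f : L2 n, mulOp _ hk (mulOp _ hk f) = mulOp _ hkk f := fun f => by
    refine mulOp_mulOp hk hk hkk (fun ξ => ?_) f
    by_cases hξ : ξ ∈ S <;> simp [hξ, sq]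
  have hx : ∀ t, 0 < t → HasDerivAt (fun t => mulOp _ h₁ (𝓕 (u t) : L2 n))
      (mulOp _ h₁ (𝓕 (timeDeriv u t) : L2 n)) t := fun t ht =>
    mulOp_hasDerivAt h₁ (fourier_hasDerivAt (h.hasDerivAt ht))
  have hy : ∀ t, 0 < t → HasDerivAt (fun t => mulOp _ h₁ (𝓕 (timeDeriv u t) : L2 n))
      (-mulOp _ hk (mulOp _ hk (mulOp _ h₁ (𝓕 (u t) : L2 n))) -
        ((μ / (1 + t) : ℝ) : ℂ) • mulOp _ h₁ (𝓕 (timeDeriv u t) : L2 n)) t := by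
    intro t ht
    have := mulOp_hasDerivAt hM (h.hasDerivAt_resolvent ht)
    simp only [map_sub, map_neg, map_smul, hMB, hMK] at this
    rwa [hkP, hLL]
  have key := energyData_of_hasDerivAt (μ := μ) (a := a) (mulOp _ hk) (inner_mulOp hk)
    ((mulOp _ h₁).continuous.comp_continuousOn h.continuousOn_fourier)
    ((mulOp _ h₁).continuous.comp_continuousOn h.continuousOn_fourier_timeDeriv) hx hy ?_ ?_
    (fun t ht => mulOp_hasDerivAt hk (hx t ht))
  · simp only [Function.comp_def, hkP] at key
    exact ⟨_, _, key⟩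
  · intro t _
    simp only [Function.comp_def, hkP]
    rw [← mul_pow]
    have : a * ‖mulOp _ h₁ (𝓕 (u t) : L2 n)‖ ≤ ‖mulOp _ hk (𝓕 (u t) : L2 n)‖ := by
      rcases ha.eq_or_lt with rfl | ha
      · simp
      · rw [← le_inv_mul_iff₀ ha]
        refine norm_mulOp_indicator_le h₁ hk (Filter.Eventually.of_forall fun ξ hξ => ?_)
        rw [le_inv_mul_iff₀ ha]
        simp only [Complex.ofReal_one, one_mul, norm_mul, Complex.norm_real,
          Real.norm_of_nonneg (freq_nonneg ξ)]
        gcongr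
        exact (hSa ξ hξ).1
    gcongr
  · intro t _
    simp only [Function.comp_def, hkP]
    have : ‖mulOp _ hk (𝓕 (u t) : L2 n)‖ ≤ (2 * a) * ‖mulOp _ h₁ (𝓕 (u t) : L2 n)‖ := by
      refine norm_mulOp_indicator_le hk h₁ (Filter.Eventually.of_forall fun ξ hξ => ?_)
      simp only [Complex.ofReal_one, one_mul, norm_mul, Complex.norm_real,
          Real.norm_of_nonneg (freq_nonneg ξ)]
      gcongr
      exact (hSa ξ hξ).2
    calc _ ≤ ((2 * a) * ‖mulOp _ h₁ (𝓕 (u t) : L2 n)‖) ^ 2 := by gcongr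
      _ = _ := by ring

/-! ### The spaces [D]^κ L² on the Fourier side -/

lemma fourier_fourierMul {m : EuclideanSpace ℝ (Fin n) → ℝ} {f : L2 n} (h : InDomain m f) :
    (𝓕 (fourierMul m f) : L2 n) =ᵐ[volume]
      fun ξ => (m ((2 * Real.pi) • ξ) : ℂ) * (𝓕 f : L2 n) ξ := by
  rw [fourierMul, dif_pos h, FourierTransform.fourier_fourierInv_eq]
  exact h.coeFn_toLp

lemma japanese_pos (ξ : EuclideanSpace ℝ (Fin n)) : 0 < japanese ξ := by
  rw [japanese]
  positivity

lemma norm_le_japanese (ξ : EuclideanSpace ℝ (Fin n)) : ‖ξ‖ ≤ japanese ξ :=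
  Real.le_sqrt_of_sq_le (by linarith)

lemma one_le_japanese (ξ : EuclideanSpace ℝ (Fin n)) : 1 ≤ japanese ξ :=
  Real.le_sqrt_of_sq_le (by nlinarith [sq_nonneg ‖ξ‖])

lemma bracket_nonneg (ξ : EuclideanSpace ℝ (Fin n)) : 0 ≤ bracket ξ :=
  div_nonneg (norm_nonneg _) (japanese_pos ξ).le

lemma bracket_le_one (ξ : EuclideanSpace ℝ (Fin n)) : bracket ξ ≤ 1 :=
  (div_le_one (japanese_pos ξ)).2 (norm_le_japanese ξ)

lemma bracket_le_norm (ξ : EuclideanSpace ℝ (Fin n)) : bracket ξ ≤ ‖ξ‖ :=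
  div_le_self (norm_nonneg _) (one_le_japanese ξ)

lemma measurable_bracket_rpow (κ : ℝ) :
    Measurable (fun ξ : EuclideanSpace ℝ (Fin n) => bracket ((2 * Real.pi) • ξ) ^ κ) := by
  unfold bracket japanese
  fun_prop

/-- Elements of `[D]^κ L²` on the Fourier side. -/
lemma fourier_of_mem_bracketSpace {κ : ℝ} {g : L2 n} (hg : g ∈ bracketSpace n κ) :
    (𝓕 g : L2 n) =ᵐ[volume] fun ξ =>
      ((bracket ((2 * Real.pi) • ξ) ^ κ : ℝ) : ℂ) * (𝓕 (bracketD (-κ) g) : L2 n) ξ := by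
  obtain ⟨f, hf, rfl⟩ := hg
  have h1 : (𝓕 (bracketD κ f) : L2 n) =ᵐ[volume] _ := fourier_fourierMul hf
  have hdom : InDomain (fun ξ => bracket ξ ^ (-κ)) (bracketD κ f) := by
    refine (Lp.memLp (𝓕 f : L2 n)).mono ?_ ?_
    · exact (Complex.measurable_ofReal.comp
        (measurable_bracket_rpow (-κ))).aestronglyMeasurable.mul (Lp.aestronglyMeasurable _)
    · filter_upwards [h1] with ξ h1
      rw [h1, ← mul_assoc, ← Complex.ofReal_mul, norm_mul, Complex.norm_real]
      have h0 := bracket_nonneg ((2 * Real.pi) • ξ)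
      rw [Real.norm_of_nonneg (by positivity), Real.rpow_neg h0]
      -- Where the symbol vanishes, `0⁻¹ = 0` makes the product 0, which is still at most 1.
      exact mul_le_of_le_one_left (norm_nonneg _) inv_mul_le_one
  have h2 : (𝓕 (bracketD (-κ) (bracketD κ f)) : L2 n) =ᵐ[volume] _ := fourier_fourierMul hdom
  filter_upwards [h1, h2] with ξ h1 h2
  rw [h2, h1]
  have h0 := bracket_nonneg ((2 * Real.pi) • ξ)
  rw [← mul_assoc, ← mul_assoc, ← Complex.ofReal_mul, ← Complex.ofReal_mul]
  congr 2
  rw [Real.rpow_neg h0]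
  -- At a zero of the symbol both sides vanish, whatever value its inverse is given there.
  by_cases hz : bracket ((2 * Real.pi) • ξ) ^ κ = 0
  · simp [hz]
  · field_simp

/-! ### Dyadic shells -/

/-- The dyadic decomposition of the frequency space, with the zero frequency as a piece. -/
def shell : Option ℤ → Set (EuclideanSpace ℝ (Fin n))
  -- The zero frequency cannot be dropped as a null set when n = 0, where it is the whole space.
  | none => {ξ | freq ξ = 0}
  | some j => {ξ | freq ξ ∈ Ico ((2 : ℝ) ^ j) (2 ^ (j + 1))}

/-- The lower end of the frequencies in a dyadic piece. -/
def shellFreq : Option ℤ → ℝ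
  | none => 0
  | some j => 2 ^ j

lemma shellFreq_nonneg : ∀ i, 0 ≤ shellFreq i
  | none => le_rfl
  | some j => zpow_nonneg zero_le_two j

lemma measurableSet_shell : ∀ i, MeasurableSet (shell (n := n) i)
  | none => measurable_freq (measurableSet_singleton 0)
  | some _ => measurable_freq measurableSet_Ico

lemma freq_mem_shell : ∀ i, ∀ ξ ∈ shell (n := n) i,
    shellFreq i ≤ freq ξ ∧ freq ξ ≤ 2 * shellFreq i
  | none, ξ, h => by
    have : freq ξ = 0 := h
    simp [this, shellFreq]
  | some j, ξ, h => by
    have h : freq ξ ∈ Ico ((2 : ℝ) ^ j) (2 ^ (j + 1)) := h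
    refine ⟨h.1, h.2.le.trans_eq ?_⟩
    rw [shellFreq, zpow_add_one₀ two_ne_zero, mul_comm]

lemma pairwise_disjoint_shell :
    Pairwise (Function.onFun Disjoint (shell (n := n))) := by
  have hj := (zpow_right_mono₀ (one_le_two (α := ℝ))).pairwise_disjoint_on_Ico_succ
  have h0 : ∀ j : ℤ, Disjoint (shell (n := n) none) (shell (some j)) := fun j =>
    disjoint_left.2 fun ξ (h : freq ξ = 0) (h' : freq ξ ∈ Ico ((2 : ℝ) ^ j) (2 ^ (j + 1))) => by
      have := h'.1
      rw [h] at this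
      exact absurd this (not_le.2 (zpow_pos two_pos j))
  rintro (_ | i) (_ | j) hij
  · exact absurd rfl hij
  · exact h0 j
  · exact (h0 i).symm
  · exact (hj (fun h => hij (congrArg some h))).preimage freq

lemma iUnion_shell : ⋃ i, shell (n := n) i = univ := by
  refine eq_univ_of_forall fun ξ => mem_iUnion.2 ?_
  rcases (freq_nonneg ξ).eq_or_lt with h | h
  · exact ⟨none, h.symm⟩
  · obtain ⟨j, hj⟩ := exists_mem_Ico_zpow h one_lt_two
    exact ⟨some j, hj⟩

lemma lintegral_eq_tsum_shell (F : EuclideanSpace ℝ (Fin n) → ENNReal) :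
    ∫⁻ ξ, F ξ = ∑' i, ∫⁻ ξ in shell i, F ξ := by
  rw [← lintegral_iUnion measurableSet_shell pairwise_disjoint_shell, iUnion_shell,
    setLIntegral_univ]

end

/-! ### Decay on a shell and summation -/

noncomputable section

variable {n : ℕ}

/-- The pointwise bounds for the data on the Fourier side, in terms of the weighted data. -/
lemma ae_le_of_bracket {κ : ℝ} (hκ : 0 ≤ κ) {a : ℝ} {S : Set (EuclideanSpace ℝ (Fin n))}
    (hSa : ∀ ξ ∈ S, freq ξ ≤ 2 * a) {v f : L2 n}
    (h : v =ᵐ[volume] fun ξ => ((bracket ((2 * Real.pi) • ξ) ^ κ : ℝ) : ℂ) * f ξ) :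
    ∀ᵐ ξ, ‖v ξ‖ ≤ ‖f ξ‖ ∧ (ξ ∈ S → ‖v ξ‖ ≤ (2 * a) ^ κ * ‖f ξ‖) := by
  filter_upwards [h] with ξ h
  have h0 := bracket_nonneg ((2 * Real.pi) • ξ)
  rw [h, norm_mul, Complex.norm_real, Real.norm_of_nonneg (by positivity)]
  refine ⟨mul_le_of_le_one_left (norm_nonneg _)
    (Real.rpow_le_one h0 (bracket_le_one _) hκ), fun hξ => ?_⟩
  gcongr
  exact ((bracket_le_norm _).trans_eq (norm_two_pi_smul ξ)).trans (hSa ξ hξ)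

/-- The decay of the energy on a frequency shell. -/
lemma IsSolution.shell_decay {μ κ θ : ℝ} (hμ : 2 < μ) (hκ : 0 ≤ κ) (hθ₁ : θ ≤ 1 + κ)
    (hθ₂ : 2 * θ ≤ μ) {u₁ u₂ : L2 n} {u : ℝ → L2 n} (h : IsSolution μ u₁ u₂ u)
    (hu₁ : u₁ ∈ H1 n) (hb₁ : japaneseD u₁ ∈ bracketSpace n κ) (hb₂ : u₂ ∈ bracketSpace n κ)
    {S : Set (EuclideanSpace ℝ (Fin n))} (hS : MeasurableSet S) {a : ℝ} (ha : 0 ≤ a)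
    (hSa : ∀ ξ ∈ S, a ≤ freq ξ ∧ freq ξ ≤ 2 * a) {t : ℝ} (ht : 0 ≤ t) :
    ∫⁻ ξ in S, (‖(freq ξ : ℂ) * (𝓕 (u t) : L2 n) ξ‖ₑ ^ 2 + ‖(𝓕 (timeDeriv u t) : L2 n) ξ‖ₑ ^ 2) ≤
      ENNReal.ofReal (decayConst μ κ * (1 + t) ^ (-(2 * θ))) *
        ∫⁻ ξ in S, (‖(𝓕 (bracketD (-κ) (japaneseD u₁)) : L2 n) ξ‖ₑ ^ 2 +
          ‖(𝓕 (bracketD (-κ) u₂) : L2 n) ξ‖ₑ ^ 2) := by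
  have h₁ : BoundedSymbol (S.indicator fun _ => 1) :=
    memLp_indicator hS measurable_const 1 zero_le_one (by simp)
  have hk : BoundedSymbol (S.indicator freq) :=
    memLp_indicator hS measurable_freq (2 * a) (by positivity) fun ξ hξ => by
      rw [abs_of_nonneg (freq_nonneg ξ)]
      exact (hSa ξ hξ).2
  obtain ⟨q, w, hE⟩ := h.energyData hS ha hSa h₁ hk
  set f : L2 n := 𝓕 (bracketD (-κ) (japaneseD u₁)) with hf
  set g : L2 n := 𝓕 (bracketD (-κ) u₂) with hg
  have hj : (𝓕 (japaneseD u₁) : L2 n) =ᵐ[volume] _ := fourier_fourierMul hu₁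
  have hv₁ := ae_le_of_bracket hκ (fun ξ hξ => (hSa ξ hξ).2) (fourier_of_mem_bracketSpace hb₁)
  have hv₂ := ae_le_of_bracket hκ (fun ξ hξ => (hSa ξ hξ).2) (fourier_of_mem_bracketSpace hb₂)
  have hjn : ∀ ξ : EuclideanSpace ℝ (Fin n), ∀ z : ℂ,
      ‖(japanese ((2 * Real.pi) • ξ) : ℂ) * z‖ = japanese ((2 * Real.pi) • ξ) * ‖z‖ := fun ξ z => by
    rw [norm_mul, Complex.norm_real, Real.norm_of_nonneg (japanese_pos _).le]
  -- `b₁` and `b₂` use [ξ]^κ ≤ (2a)^κ on S and give the low-frequency hypothesis of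
  -- `EnergyData.decay`; `c₁` and `c₂` use [ξ] ≤ 1 and give the high-frequency one. The factor ⟨ξ⟩
  -- on u₁ is dropped through 1 ≤ ⟨ξ⟩ in the former, and absorbs |ξ| in the latter.
  have b₁ : ‖mulOp _ h₁ (𝓕 u₁ : L2 n)‖ ≤ (2 * a) ^ κ * ‖mulOp _ h₁ f‖ := by
    refine norm_mulOp_indicator_le h₁ h₁ ?_
    filter_upwards [hj, hv₁] with ξ hj hv hξ
    have := hv.2 hξ
    rw [hj, hjn] at this
    simp only [Complex.ofReal_one, one_mul]
    exact (le_mul_of_one_le_left (norm_nonneg _) (one_le_japanese _)).trans this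
  have b₂ : ‖mulOp _ h₁ (𝓕 u₂ : L2 n)‖ ≤ (2 * a) ^ κ * ‖mulOp _ h₁ g‖ := by
    refine norm_mulOp_indicator_le h₁ h₁ ?_
    filter_upwards [hv₂] with ξ hv hξ
    simpa only [Complex.ofReal_one, one_mul] using hv.2 hξ
  have c₁ : ‖mulOp _ hk (𝓕 u₁ : L2 n)‖ ≤ 1 * ‖mulOp _ h₁ f‖ := by
    refine norm_mulOp_indicator_le hk h₁ ?_
    filter_upwards [hj, hv₁] with ξ hj hv hξ
    have := hv.1
    rw [hj, hjn] at this
    simp only [Complex.ofReal_one, one_mul, norm_mul, Complex.norm_real,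
      Real.norm_of_nonneg (freq_nonneg ξ)]
    refine le_trans ?_ this
    gcongr
    exact (norm_two_pi_smul ξ).symm.le.trans (norm_le_japanese _)
  have c₂ : ‖mulOp _ h₁ (𝓕 u₂ : L2 n)‖ ≤ 1 * ‖mulOp _ h₁ g‖ := by
    refine norm_mulOp_indicator_le h₁ h₁ ?_
    filter_upwards [hv₂] with ξ hv hξ
    simpa only [Complex.ofReal_one, one_mul] using hv.1
  have hsq : ((2 * a) ^ κ) ^ 2 = (2 * a) ^ (2 * κ) := by
    rw [← Real.rpow_natCast, ← Real.rpow_mul (by positivity), mul_comm κ]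
    norm_num
  have key := hE.decay hμ hκ (d := ‖mulOp _ h₁ f‖ ^ 2 + ‖mulOp _ h₁ g‖ ^ 2) (θ := θ) ha
    (by positivity) hθ₁ hθ₂ ?_ ?_ ht
  · have hK : 0 ≤ decayConst μ κ * (1 + t) ^ (-(2 * θ)) := by
      unfold decayConst
      positivity
    have hsum : ∀ x y : L2 n, ‖x‖ₑ ^ 2 + ‖y‖ₑ ^ 2 = ENNReal.ofReal (‖x‖ ^ 2 + ‖y‖ ^ 2) :=
      fun x y => by
      rw [ENNReal.ofReal_add (by positivity) (by positivity), ENNReal.ofReal_pow (norm_nonneg _),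
        ENNReal.ofReal_pow (norm_nonneg _), ofReal_norm, ofReal_norm]
    have hloc : ∀ x : L2 n, ∫⁻ ξ in S, ‖x ξ‖ₑ ^ 2 = ‖mulOp _ h₁ x‖ₑ ^ 2 := fun x => by
      rw [enorm_mulOp_indicator_sq hS]
      simp
    have hmeas : ∀ x : L2 n, AEMeasurable (fun ξ => ‖x ξ‖ₑ ^ 2) (volume.restrict S) := fun x =>
      ((Lp.aestronglyMeasurable x).enorm.pow_const 2).restrict
    rw [lintegral_add_right' _ (hmeas _), lintegral_add_right' _ (hmeas _), hloc, hloc, hloc,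
      ← enorm_mulOp_indicator_sq hS hk, hsum, hsum, ← ENNReal.ofReal_mul hK]
    refine ENNReal.ofReal_le_ofReal ?_
    linarith
  · simp only [h.initial, h.initial_deriv]
    rw [mul_add, ← hsq, ← mul_pow, ← mul_pow]
    gcongr
  · simp only [h.initial, h.initial_deriv]
    rw [one_mul] at c₁ c₂
    rw [add_comm]
    gcongr

/-- The decay of the energy, in terms of the weighted data. -/
lemma IsSolution.energy_decay {μ κ θ : ℝ} (hμ : 2 < μ) (hκ : 0 ≤ κ) (hθ₁ : θ ≤ 1 + κ)
    (hθ₂ : 2 * θ ≤ μ) {u₁ u₂ : L2 n} {u : ℝ → L2 n} (h : IsSolution μ u₁ u₂ u)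
    (hu₁ : u₁ ∈ H1 n) (hb₁ : japaneseD u₁ ∈ bracketSpace n κ) (hb₂ : u₂ ∈ bracketSpace n κ)
    {t : ℝ} (ht : 0 ≤ t) :
    ‖absD (u t)‖ ^ 2 + ‖timeDeriv u t‖ ^ 2 ≤ decayConst μ κ * (1 + t) ^ (-(2 * θ)) *
      (bracketNorm κ (japaneseD u₁) ^ 2 + bracketNorm κ u₂ ^ 2) := by
  have hK : 0 ≤ decayConst μ κ * (1 + t) ^ (-(2 * θ)) := by
    unfold decayConst
    positivity
  have hsum : ∀ x y : L2 n, ENNReal.ofReal (‖x‖ ^ 2 + ‖y‖ ^ 2) =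
      ∫⁻ ξ, (‖(𝓕 x : L2 n) ξ‖ₑ ^ 2 + ‖(𝓕 y : L2 n) ξ‖ₑ ^ 2) := fun x y => by
    rw [lintegral_add_right' _ ((Lp.aestronglyMeasurable _).enorm.pow_const 2),
      ← enorm_sq_eq_lintegral, ← enorm_sq_eq_lintegral,
      ENNReal.ofReal_add (by positivity) (by positivity), ← Lp.norm_fourier_eq x,
      ← Lp.norm_fourier_eq y, ENNReal.ofReal_pow (norm_nonneg _),
      ENNReal.ofReal_pow (norm_nonneg _), ofReal_norm, ofReal_norm]
  have hdom : InDomain (fun ξ => ‖ξ‖) (u t) := by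
    refine (h.mem_H1 t ht).mono ?_ (Filter.Eventually.of_forall fun ξ => ?_)
    · exact (Complex.measurable_ofReal.comp (by fun_prop)).aestronglyMeasurable.mul
        (Lp.aestronglyMeasurable _)
    · rw [norm_mul, norm_mul, Complex.norm_real, Complex.norm_real, norm_norm,
        Real.norm_of_nonneg (japanese_pos _).le]
      gcongr
      exact norm_le_japanese _
  have habs : (𝓕 (absD (u t)) : L2 n) =ᵐ[volume] _ := fourier_fourierMul hdom
  unfold bracketNorm
  rw [← ENNReal.ofReal_le_ofReal_iff (by positivity), ENNReal.ofReal_mul hK, hsum, hsum]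
  calc ∫⁻ ξ, (‖(𝓕 (absD (u t)) : L2 n) ξ‖ₑ ^ 2 + ‖(𝓕 (timeDeriv u t) : L2 n) ξ‖ₑ ^ 2)
      = ∫⁻ ξ, (‖(freq ξ : ℂ) * (𝓕 (u t) : L2 n) ξ‖ₑ ^ 2 +
          ‖(𝓕 (timeDeriv u t) : L2 n) ξ‖ₑ ^ 2) := by
        refine lintegral_congr_ae ?_
        filter_upwards [habs] with ξ hξ
        rw [hξ, norm_two_pi_smul]
    _ ≤ _ := by
        -- The constant does not depend on the shell, so the bounds add up; in `ENNReal` no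
        -- convergence needs checking.
        rw [lintegral_eq_tsum_shell, lintegral_eq_tsum_shell, ← ENNReal.tsum_mul_left]
        exact ENNReal.tsum_le_tsum fun i => h.shell_decay hμ hκ hθ₁ hθ₂ hu₁ hb₁ hb₂
          (measurableSet_shell i) (shellFreq_nonneg i) (freq_mem_shell i) ht

lemma decayConst_pos {μ κ : ℝ} (hμ : 2 < μ) : 0 < decayConst μ κ := by
  have : 0 < μ := by linarith
  unfold decayConst
  positivity

/-- The square root of `energy_decay`: (x+y)² ≤ 2(x²+y²) on the left accounts for the 2 in the
constant, and A² + B² ≤ (A+B)² is used on the right. -/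
lemma IsSolution.decay {μ κ θ : ℝ} (hμ : 2 < μ) (hκ : 0 ≤ κ) (hθ₁ : θ ≤ 1 + κ)
    (hθ₂ : 2 * θ ≤ μ) {u₁ u₂ : L2 n} {u : ℝ → L2 n} (h : IsSolution μ u₁ u₂ u)
    (hu₁ : u₁ ∈ H1 n) (hb₁ : japaneseD u₁ ∈ bracketSpace n κ) (hb₂ : u₂ ∈ bracketSpace n κ)
    {t : ℝ} (ht : 0 ≤ t) :
    ‖absD (u t)‖ + ‖timeDeriv u t‖ ≤ Real.sqrt (2 * decayConst μ κ) *
      (bracketNorm κ (japaneseD u₁) + bracketNorm κ u₂) * (1 + t) ^ (-θ) := by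
  have hτ : 0 < 1 + t := by positivity
  have hK := decayConst_pos (κ := κ) hμ
  have hE := h.energy_decay hμ hκ hθ₁ hθ₂ hu₁ hb₁ hb₂ ht
  have hf : 0 ≤ bracketNorm κ (japaneseD u₁) := norm_nonneg _
  have hg : 0 ≤ bracketNorm κ u₂ := norm_nonneg _
  refine (abs_le_of_sq_le_sq' ?_ (by positivity)).2
  have e : ((1 + t) ^ (-θ)) ^ 2 = (1 + t) ^ (-(2 * θ)) := by
    rw [← Real.rpow_natCast, ← Real.rpow_mul hτ.le]
    congr 1
    push_cast
    ring
  rw [mul_pow, mul_pow, Real.sq_sqrt (by positivity), e]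
  calc (‖absD (u t)‖ + ‖timeDeriv u t‖) ^ 2
      ≤ 2 * (‖absD (u t)‖ ^ 2 + ‖timeDeriv u t‖ ^ 2) := add_sq_le
    _ ≤ 2 * (decayConst μ κ * (1 + t) ^ (-(2 * θ)) *
        (bracketNorm κ (japaneseD u₁) + bracketNorm κ u₂) ^ 2) := by
      refine mul_le_mul_of_nonneg_left (hE.trans ?_) zero_le_two
      gcongr
      nlinarith
    _ = _ := by ring

end

end DissipativeWave

theorem theorem3p1 (n : ℕ) (μ : ℝ) (hμ : 2 < μ) (κ : ℝ) (hκ : 0 ≤ κ) :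
    ∃ C : ℝ, 0 < C ∧
      ∀ u₁ u₂ : DissipativeWave.L2 n,
        u₁ ∈ DissipativeWave.H1 n →
        DissipativeWave.japaneseD u₁ ∈ DissipativeWave.bracketSpace n κ →
        u₂ ∈ DissipativeWave.bracketSpace n κ →
        ∀ u : ℝ → DissipativeWave.L2 n, DissipativeWave.IsSolution μ u₁ u₂ u →
          ∀ t : ℝ, 0 ≤ t →
            (κ ≤ (μ - 2) / 2 →
              ‖DissipativeWave.absD (u t)‖ + ‖DissipativeWave.timeDeriv u t‖ ≤
                C * (DissipativeWave.bracketNorm κ (DissipativeWave.japaneseD u₁)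
                  + DissipativeWave.bracketNorm κ u₂) * (1 + t) ^ (-1 - κ)) ∧
            ((μ - 2) / 2 ≤ κ →
              ‖DissipativeWave.absD (u t)‖ + ‖DissipativeWave.timeDeriv u t‖ ≤
                C * (DissipativeWave.bracketNorm κ (DissipativeWave.japaneseD u₁)
                  + DissipativeWave.bracketNorm κ u₂) * (1 + t) ^ (-μ / 2)) := by
  refine ⟨Real.sqrt (2 * DissipativeWave.decayConst μ κ), Real.sqrt_pos.2
    (mul_pos two_pos (DissipativeWave.decayConst_pos hμ)), ?_⟩
  intro u₁ u₂ hu₁ hb₁ hb₂ u h t ht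
  -- The two exponents are the two ceilings on θ, namely 1 + κ and μ/2; the case hypothesis says
  -- that the one chosen respects the other.
  refine ⟨fun hle => ?_, fun hge => ?_⟩
  · have := h.decay (θ := 1 + κ) hμ hκ le_rfl (by linarith) hu₁ hb₁ hb₂ ht
    rwa [show -(1 + κ) = -1 - κ by ring] at this
  · have := h.decay (θ := μ / 2) hμ hκ (by linarith) (by linarith) hu₁ hb₁ hb₂ ht
    rwa [show -(μ / 2) = -μ / 2 by ring] at this
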